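/- Let $X$ be a finite set, $\mathcal F(X)$ the free group on $X$, whose elements are identified with the reduced words on $X\cup X^{-1}$, and let $|w|$ denote the length of a word $w$. Let $\langle X\mid R\rangle$ be a group presentation, where $R\subseteq\mathcal F(X)$ is closed under taking inverses, and let $\mathcal N$ be the normal closure of $R$ in $\mathcal F(X)$; its elements are called relators. For $w\in\mathcal N$ let $\mathrm{area}(w)$ be the least $k$, and $\mathrm{gwork}(w)$ the least value of $|r_1|+\dots+|r_k|$, over all expressions $w=a_1r_1a_1^{-1}\cdots a_kr_ka_k^{-1}$ in $\mathcal F(X)$ with $k\ge 0$, $a_i\in\mathcal F(X)$, $r_i\in R$. For $n\in\mathbb N$ let $$\Delta(n)=\max\{\mathrm{area}(w): w\in\mathcal N,\ |w|\le n\},\qquad \Omega_g(n)=\max\{\mathrm{gwork}(w): w\in\mathcal N,\ |w|\le n\}.$$ The corresponding monoid presentation has the set of generators $X\cup X^{-1}$ and the defining relations $(u,v^{-1})$ for all words $u,v$ whose concatenation $uv$ is an element of $R$, together with $(xx^{-1},1)$ for all $x\in X\cup X^{-1}$. A pair of (not necessarily reduced) words is called a relation if it belongs to the congruence generated by the defining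 relations on the free monoid on $X\cup X^{-1}$. A step of a derivation replaces a word $paq$ by $pbq$, where $(a,b)$ or $(b,a)$ is a defining relation, and its work is $|a|+|b|$; the work of a derivation is the sum of the works of its steps. For a relation $(u,v)$ let $\mathrm{dl}(u,v)$ be the least number of steps, and $\mathrm{work}(u,v)$ the least work, of a derivation from $u$ to $v$, and let $\mathrm{DL}(n_1,n_2)$ and $\Omega(n_1,n_2)$ be the maxima of $\mathrm{dl}(u,v)$ and of $\mathrm{work}(u,v)$, respectively, over all relations $(u,v)$ with $|u|\le n_1$ and $|v|\le n_2$. Then for every natural number $n$ $$\Omega_g(n)\le\Omega(n,0)\qquad\text{and}\qquad \Delta(n)\le\mathrm{DL}(n,0).$$ Moreover, if $n=0$ or there is a relator $w\neq 1$ with $|w|\le n$, then: 1. $\Omega(n,0)\le 4\,\Omega_g(n)^3+\Omega_g(n)^2+(4n+1)\,\Omega_g(n)-n$; 2. if $c$ is a natural number such that $|r|\le c$ for every $r\in R$, then $$\mathrm{DL}(n,0)\le 2c\,\Delta(n)^2+\left(2n+\frac c2+1\right)\Delta(n)-\frac n2$$ and $$\Omega(n,0)\le 4c\,\Omega_g(n)^2+(4n+c+1)\,\Omega_g(n)-n.$$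 -/

import Mathlib

namespace Presentation

section Monoid

/-! ### Monoid presentations
A monoid presentation `< A | S >` is a set `S` of pairs of words on `A`, that is, of elements of
the free monoid `FreeMonoid A`. -/

variable {A : Type*}

/-- `(u, v)` is a relation of `< A | S >`: it belongs to the congruence generated by `S`. -/
def IsRelation (S : Set (FreeMonoid A × FreeMonoid A)) (u v : FreeMonoid A) : Prop :=
  conGen (fun a b => (a, b) ∈ S) u v

/-- The symmetrized set of `S`. -/
def symmetrized (S : Set (FreeMonoid A × FreeMonoid A)) : Set (FreeMonoid A × FreeMonoid A) :=
  S ∪ {p | (p.2, p.1) ∈ S}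

/-- `Derives S k m u v`: there is a derivation from `u` to `v` with `k` steps and of work `m`.
A step replaces a factor `a` by `b`, where `(a, b)` is in the symmetrized set of defining
relations, and its work is `|a| + |b|`. -/
inductive Derives (S : Set (FreeMonoid A × FreeMonoid A)) :
    ℕ → ℕ → FreeMonoid A → FreeMonoid A → Prop
  | refl (u : FreeMonoid A) : Derives S 0 0 u u
  | step {k m : ℕ} {u : FreeMonoid A} (x a b y : FreeMonoid A)
      (h : Derives S k m u (x * a * y)) (hab : (a, b) ∈ symmetrized S) :
      Derives S (k + 1) (m + (a.length + b.length)) u (x * b * y)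

/-- The derivational length of `(u, v)`: the least number of steps of a derivation. -/
noncomputable def dl (S : Set (FreeMonoid A × FreeMonoid A)) (u v : FreeMonoid A) : ℕ :=
  sInf {k | ∃ m, Derives S k m u v}

/-- The (derivational) work of `(u, v)`: the least work of a derivation. -/
noncomputable def work (S : Set (FreeMonoid A × FreeMonoid A)) (u v : FreeMonoid A) : ℕ :=
  sInf {m | ∃ k, Derives S k m u v}

/-- The derivational length of `< A | S >` at `(n₁, n₂)`
(a maximum for finite `A`, see `isGreatest_DL`). -/
noncomputable def DL (S : Set (FreeMonoid A × FreeMonoid A)) (n₁ n₂ : ℕ) : ℕ :=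
  sSup {k | ∃ u v, IsRelation S u v ∧ u.length ≤ n₁ ∧ v.length ≤ n₂ ∧ dl S u v = k}

/-- The (derivational) work of `< A | S >` at `(n₁, n₂)`
(a maximum for finite `A`, see `isGreatest_Work`). -/
noncomputable def Work (S : Set (FreeMonoid A × FreeMonoid A)) (n₁ n₂ : ℕ) : ℕ :=
  sSup {m | ∃ u v, IsRelation S u v ∧ u.length ≤ n₁ ∧ v.length ≤ n₂ ∧ work S u v = m}

end Monoid

section Group

/-! ### Group presentations
A group presentation `< X | R >` is a set `R` of elements of the free group on `X`; an element of
the free group is identified with its reduced word `w.toWord`, of length `w.norm`. The letters of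
`X ∪ X⁻¹` are the elements of `X × Bool`, the inverse of `(x, b)` being `(x, !b)`. -/

variable {X : Type*} [DecidableEq X]

/-- The defining relations `(x x⁻¹, 1)`, for every letter `x` of `X ∪ X⁻¹`. -/
def cancellations (X : Type*) : Set (FreeMonoid (X × Bool) × FreeMonoid (X × Bool)) :=
  {p | ∃ (x : X) (b : Bool), p = (FreeMonoid.of (x, b) * FreeMonoid.of (x, !b), 1)}

/-- The defining relations of the monoid presentation corresponding to `< X | R >`: the pairs
`(u, v⁻¹)` where the word `u v` is a defining relator, and the cancellations. -/
def toMonoid (R : Set (FreeGroup X)) : Set (FreeMonoid (X × Bool) × FreeMonoid (X × Bool)) :=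
  {p | ∃ r ∈ R, ∃ u v : List (X × Bool), r.toWord = u ++ v ∧
      p = (FreeMonoid.ofList u, FreeMonoid.ofList (FreeGroup.invRev v))} ∪ cancellations X

/-- `IsProductOfConjugates R l w`: `w = a₁ r₁ a₁⁻¹ ⋯ a_k r_k a_k⁻¹` in the free group, where the
`r_i` are in `R` and `l` is the list of the pairs `(a_i, r_i)`. -/
def IsProductOfConjugates (R : Set (FreeGroup X)) (l : List (FreeGroup X × FreeGroup X))
    (w : FreeGroup X) : Prop :=
  (∀ p ∈ l, p.2 ∈ R) ∧ (l.map fun p => p.1 * p.2 * p.1⁻¹).prod = w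

/-- The area of a relator `w`. -/
noncomputable def area (R : Set (FreeGroup X)) (w : FreeGroup X) : ℕ :=
  sInf {k | ∃ l, IsProductOfConjugates R l w ∧ l.length = k}

/-- The group work of a relator `w`. -/
noncomputable def gwork (R : Set (FreeGroup X)) (w : FreeGroup X) : ℕ :=
  sInf {m | ∃ l, IsProductOfConjugates R l w ∧ (l.map fun p => p.2.norm).sum = m}

/-- The Dehn function of `< X | R >` (a maximum for finite `X`, see `isGreatest_dehn`). -/
noncomputable def dehn (R : Set (FreeGroup X)) (n : ℕ) : ℕ :=
  sSup {k | ∃ w ∈ Subgroup.normalClosure R, w.norm ≤ n ∧ area R w = k}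

/-- The group work of `< X | R >` (a maximum for finite `X`, see `isGreatest_groupWork`). -/
noncomputable def groupWork (R : Set (FreeGroup X)) (n : ℕ) : ℕ :=
  sSup {m | ∃ w ∈ Subgroup.normalClosure R, w.norm ≤ n ∧ gwork R w = m}

end Group

/-! ### The minima and maxima in the definitions exist -/

section Facts

variable {A : Type*} {S : Set (FreeMonoid A × FreeMonoid A)}

theorem Derives.comp {k₁ m₁ k₂ m₂ : ℕ} {u v w : FreeMonoid A} (h₁ : Derives S k₁ m₁ u v)
    (h₂ : Derives S k₂ m₂ v w) : Derives S (k₁ + k₂) (m₁ + m₂) u w := by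
  induction h₂ with
  | refl => exact h₁
  | step x a b y _ hab ih =>
    have := Derives.step x a b y (ih h₁) hab
    rwa [add_assoc, add_assoc] at this

theorem Derives.context {k m : ℕ} {u v : FreeMonoid A} (h : Derives S k m u v)
    (p q : FreeMonoid A) : Derives S k m (p * u * q) (p * v * q) := by
  induction h with
  | refl => exact .refl _
  | step x a b y _ hab ih =>
    have e : ∀ c, p * (x * c * y) * q = (p * x) * c * (y * q) := fun c => by
      simp only [mul_assoc]
    rw [e] at ih
    rw [e]
    exact .step _ a b _ ih hab

theorem Derives.of_mem {a b : FreeMonoid A} (h : (a, b) ∈ symmetrized S) :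
    Derives S 1 (a.length + b.length) a b := by
  have := Derives.step (S := S) 1 a b 1 (by simpa using Derives.refl a) h
  simpa using this

theorem symmetrized_symm {a b : FreeMonoid A} (h : (a, b) ∈ symmetrized S) :
    (b, a) ∈ symmetrized S := by
  rcases h with h | h
  · exact Or.inr h
  · exact Or.inl h

theorem Derives.reverse {k m : ℕ} {u v : FreeMonoid A} (h : Derives S k m u v) :
    Derives S k m v u := by
  induction h with
  | refl => exact .refl _
  | step x a b y _ hab ih =>
    have := ((Derives.of_mem (symmetrized_symm hab)).context x y).comp ih
    convert! this using 1 <;> omega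

/-- The relations are exactly the pairs of words that are joined by a derivation. -/
theorem isRelation_iff {u v : FreeMonoid A} :
    IsRelation S u v ↔ ∃ k m, Derives S k m u v := by
  constructor
  · intro h
    change ConGen.Rel (fun a b => (a, b) ∈ S) u v at h
    induction h with
    | of x y h => exact ⟨_, _, Derives.of_mem (Or.inl h)⟩
    | refl x => exact ⟨_, _, .refl x⟩
    | symm _ ih =>
      obtain ⟨k, m, h⟩ := ih
      exact ⟨k, m, h.reverse⟩
    | trans _ _ ih₁ ih₂ =>
      obtain ⟨k₁, m₁, h₁⟩ := ih₁
      obtain ⟨k₂, m₂, h₂⟩ := ih₂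
      exact ⟨_, _, h₁.comp h₂⟩
    | @mul w x y z _ _ ih₁ ih₂ =>
      obtain ⟨k₁, m₁, h₁⟩ := ih₁
      obtain ⟨k₂, m₂, h₂⟩ := ih₂
      have a := h₁.context 1 y
      have b := h₂.context x 1
      simp only [one_mul, mul_one] at a b
      exact ⟨_, _, a.comp b⟩
  · rintro ⟨k, m, h⟩
    induction h with
    | refl u => exact (conGen _).refl u
    | step x a b y _ hab ih =>
      refine (conGen _).trans ih ?_
      refine (conGen _).mul ((conGen _).mul ((conGen _).refl x) ?_) ((conGen _).refl y)
      rcases hab with h | h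
      · exact ConGen.Rel.of _ _ h
      · exact (conGen _).symm (ConGen.Rel.of _ _ h)

theorem finite_values {A : Type*} [Finite A] (P : FreeMonoid A → FreeMonoid A → Prop)
    (f : FreeMonoid A → FreeMonoid A → ℕ) (n₁ n₂ : ℕ) :
    {k | ∃ u v, P u v ∧ u.length ≤ n₁ ∧ v.length ≤ n₂ ∧ f u v = k}.Finite := by
  have h : ∀ n, {u : FreeMonoid A | u.length ≤ n}.Finite := fun n => List.finite_length_le A n
  refine (((h n₁).prod (h n₂)).image fun p => f p.1 p.2).subset ?_
  rintro k ⟨u, v, _, hu, hv, rfl⟩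
  exact ⟨(u, v), ⟨hu, hv⟩, rfl⟩

theorem isGreatest_DL [Finite A] (S : Set (FreeMonoid A × FreeMonoid A)) (n₁ n₂ : ℕ) :
    IsGreatest {k | ∃ u v, IsRelation S u v ∧ u.length ≤ n₁ ∧ v.length ≤ n₂ ∧ dl S u v = k}
      (DL S n₁ n₂) := by
  have hb := (finite_values (IsRelation S) (dl S) n₁ n₂).bddAbove
  exact ⟨Nat.sSup_mem ⟨_, 1, 1, (conGen _).refl 1, by simp, by simp, rfl⟩ hb,
    fun _ h => le_csSup hb h⟩

theorem isGreatest_Work [Finite A] (S : Set (FreeMonoid A × FreeMonoid A)) (n₁ n₂ : ℕ) :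
    IsGreatest {m | ∃ u v, IsRelation S u v ∧ u.length ≤ n₁ ∧ v.length ≤ n₂ ∧ work S u v = m}
      (Work S n₁ n₂) := by
  have hb := (finite_values (IsRelation S) (work S) n₁ n₂).bddAbove
  exact ⟨Nat.sSup_mem ⟨_, 1, 1, (conGen _).refl 1, by simp, by simp, rfl⟩ hb,
    fun _ h => le_csSup hb h⟩

/-- If `R` is closed under inversion, every relator is a product of conjugates of elements of
`R`. -/
theorem exists_isProductOfConjugates {X : Type*} {R : Set (FreeGroup X)} (hR : ∀ r ∈ R, r⁻¹ ∈ R)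
    {w : FreeGroup X} (hw : w ∈ Subgroup.normalClosure R) :
    ∃ l, IsProductOfConjugates R l w := by
  refine Subgroup.closure_induction'' (p := fun g _ => ∃ l, IsProductOfConjugates R l g)
    ?_ ?_ ?_ ?_ hw
  · intro x hx
    obtain ⟨r, hr, h⟩ := Group.mem_conjugatesOfSet_iff.1 hx
    obtain ⟨a, rfl⟩ := isConj_iff.1 h
    exact ⟨[(a, r)], by simp [IsProductOfConjugates, hr]⟩
  · intro x hx
    obtain ⟨r, hr, h⟩ := Group.mem_conjugatesOfSet_iff.1 hx
    obtain ⟨a, rfl⟩ := isConj_iff.1 h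
    exact ⟨[(a, r⁻¹)], by simp [hR r hr], by simp [mul_assoc]⟩
  · exact ⟨[], by simp [IsProductOfConjugates]⟩
  · rintro x y _ _ ⟨l₁, h₁, rfl⟩ ⟨l₂, h₂, rfl⟩
    refine ⟨l₁ ++ l₂, ?_, by simp⟩
    intro p hp
    rcases List.mem_append.1 hp with h | h
    · exact h₁ p h
    · exact h₂ p h

theorem finite_values_group {X : Type*} [DecidableEq X] [Finite X] (P : FreeGroup X → Prop)
    (f : FreeGroup X → ℕ) (n : ℕ) : {k | ∃ w, P w ∧ w.norm ≤ n ∧ f w = k}.Finite := by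
  have h : {w : FreeGroup X | w.norm ≤ n}.Finite :=
    (List.finite_length_le (X × Bool) n).preimage FreeGroup.toWord_injective.injOn
  refine (h.image f).subset ?_
  rintro k ⟨w, _, hw, rfl⟩
  exact ⟨w, hw, rfl⟩

theorem isGreatest_dehn {X : Type*} [DecidableEq X] [Finite X] (R : Set (FreeGroup X))
    (n : ℕ) :
    IsGreatest {k | ∃ w ∈ Subgroup.normalClosure R, w.norm ≤ n ∧ area R w = k} (dehn R n) := by
  have hb := (finite_values_group (· ∈ Subgroup.normalClosure R) (area R) n).bddAbove
  exact ⟨Nat.sSup_mem ⟨_, 1, one_mem _, by simp, rfl⟩ hb, fun _ h => le_csSup hb h⟩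

theorem isGreatest_groupWork {X : Type*} [DecidableEq X] [Finite X] (R : Set (FreeGroup X))
    (n : ℕ) :
    IsGreatest {m | ∃ w ∈ Subgroup.normalClosure R, w.norm ≤ n ∧ gwork R w = m}
      (groupWork R n) := by
  have hb := (finite_values_group (· ∈ Subgroup.normalClosure R) (gwork R) n).bddAbove
  exact ⟨Nat.sSup_mem ⟨_, 1, one_mem _, by simp, rfl⟩ hb, fun _ h => le_csSup hb h⟩

end Facts

end Presentation

/-! Lower bounds: a derivation step from `p a q` to `p b q` changes the value of the word by a
conjugate of `a b⁻¹`, which is either trivial or an element of `R` whose length is the work of the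
step. So a derivation of `w` to `1` yields an expression of `w` with at most as many factors as
steps and total length at most the work (`Derives.exists_isConjProd`).

Upper bounds: in a van Kampen diagram of a relator `x w`, the boundary edge `x` either lies on a
face, which can be removed, or is a bridge, along which the diagram splits in two.
`exposed_or_mated` proves this dichotomy purely algebraically, keeping track of the number of
factors and of their total length `m`. Turning both alternatives into derivation steps,
`IsConjProd.exists_derives` derives `w` to `1` with work at most `|w| + 4m` and at most `(|w| + 3m)
/ 2` steps.

Hence `Ω(n,0) ≤ n + 4 Ω_g(n)` and `2 DL(n,0) ≤ n + 3c Δ(n)`. These linear bounds imply the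
polynomial ones when `Ω_g(n)`, `Δ(n)` and `c` are at least 1, which a nontrivial relator of length
at most `n` ensures; the case `n = 0` is trivial. -/

namespace Presentation

open FreeGroup

/-! ### Cancellation in words -/

section Words

variable {X : Type*}

theorem mk_append (u v : List (X × Bool)) : mk (u ++ v) = mk u * mk v := mul_mk.symm

theorem mk_cons (x : X × Bool) (w : List (X × Bool)) : mk (x :: w) = mk [x] * mk w :=
  mk_append [x] w

theorem mk_inv_letter (x : X × Bool) : mk [(x.1, !x.2)] = (mk [x])⁻¹ := by
  simp [inv_mk, invRev]

theorem mk_invRev (w : List (X × Bool)) : mk (invRev w) = (mk w)⁻¹ := inv_mk.symm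

theorem mk_split (x : X × Bool) (p q : List (X × Bool)) :
    mk (p ++ (x.1, !x.2) :: q) = mk p * (mk [x])⁻¹ * mk q := by
  rw [mk_append, mk_cons, mk_inv_letter, mul_assoc]

theorem split_of_append_eq {A : Type*} {u v p q : List A} {y : A} (h : u ++ v = p ++ y :: q) :
    (∃ t, u = p ++ y :: t ∧ q = t ++ v) ∨ (∃ t, v = t ++ y :: q ∧ p = u ++ t) := by
  rcases List.append_eq_append_iff.1 h with ⟨t, rfl, rfl⟩ | ⟨t, rfl, ht⟩
  · exact .inr ⟨t, rfl, rfl⟩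
  · cases t with
    | nil => exact .inr ⟨[], by simpa using ht.symm, by simp⟩
    | cons z t =>
      simp only [List.cons_append, List.cons.injEq] at ht
      obtain ⟨rfl, rfl⟩ := ht
      exact .inl ⟨t, rfl, rfl⟩

theorem invRev_split {w p q : List (X × Bool)} {x : X × Bool}
    (h : invRev w = p ++ (x.1, !x.2) :: q) : w = invRev q ++ x :: invRev p := by
  rw [← invRev_invRev (L₁ := w), h]
  simp [invRev]

/-- Undo the reduction one step at a time: each reinserted pair falls on one side of the surviving
letter and leaves the value of that side unchanged. -/
theorem split_of_red_singleton {L : List (X × Bool)} {y : X × Bool} (h : Red L [y]) :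
    ∃ p q, L = p ++ y :: q ∧ mk p = 1 ∧ mk q = 1 := by
  induction h using Relation.ReflTransGen.head_induction_on with
  | refl => exact ⟨[], [], rfl, rfl, rfl⟩
  | head hs _ ih =>
    obtain ⟨p, q, e, hp, hq⟩ := ih
    cases hs with
    | @not A B z b =>
      have hz : ∀ s t : List (X × Bool), mk (s ++ (z, b) :: (z, !b) :: t) = mk (s ++ t) :=
        fun s t => Quot.sound Red.Step.not
      rcases split_of_append_eq e with ⟨t, rfl, rfl⟩ | ⟨t, rfl, rfl⟩
      · exact ⟨p, t ++ (z, b) :: (z, !b) :: B, by simp, hp, by rw [hz, hq]⟩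
      · exact ⟨A ++ (z, b) :: (z, !b) :: t, q, by simp, by rw [hz, hp], hq⟩

theorem split_of_mul_eq_one {w : List (X × Bool)} {x : X × Bool} (h : mk [x] * mk w = 1) :
    ∃ p q, w = p ++ (x.1, !x.2) :: q ∧ mk p = 1 ∧ mk q = 1 := by
  apply split_of_red_singleton
  rw [mul_mk, one_eq_mk] at h
  have := Red.exact.1 h
  obtain ⟨c, h₁, h₂⟩ := this
  rw [Red.nil_iff] at h₂
  subst h₂
  exact Red.cons_nil_iff_singleton.1 h₁

end Words

/-! ### Counted products of conjugates -/

section ConjProd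

variable {X : Type*} [DecidableEq X] {R : Set (FreeGroup X)}

/-- `g` is a product of `k` conjugates of elements of `R`, of total norm `m`. -/
def IsConjProd (R : Set (FreeGroup X)) (k m : ℕ) (g : FreeGroup X) : Prop :=
  ∃ l, IsProductOfConjugates R l g ∧ l.length = k ∧ (l.map fun p => p.2.norm).sum = m

theorem IsConjProd.one : IsConjProd R 0 0 1 :=
  ⟨[], by simp [IsProductOfConjugates], rfl, rfl⟩

theorem IsConjProd.single {r : FreeGroup X} (hr : r ∈ R) (a : FreeGroup X) :
    IsConjProd R 1 r.norm (a * r * a⁻¹) :=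
  ⟨[(a, r)], by simp [IsProductOfConjugates, hr], rfl, by simp⟩

theorem IsConjProd.mul {k₁ m₁ k₂ m₂ : ℕ} {g h : FreeGroup X} (hg : IsConjProd R k₁ m₁ g)
    (hh : IsConjProd R k₂ m₂ h) : IsConjProd R (k₁ + k₂) (m₁ + m₂) (g * h) := by
  obtain ⟨l₁, ⟨h₁, rfl⟩, rfl, rfl⟩ := hg
  obtain ⟨l₂, ⟨h₂, rfl⟩, rfl, rfl⟩ := hh
  refine ⟨l₁ ++ l₂, ⟨fun p hp => ?_, by simp⟩, by simp, by simp⟩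
  rcases List.mem_append.1 hp with h | h
  · exact h₁ p h
  · exact h₂ p h

theorem IsConjProd.zero {m : ℕ} {g : FreeGroup X} (h : IsConjProd R 0 m g) : g = 1 ∧ m = 0 := by
  obtain ⟨l, ⟨_, rfl⟩, hl, rfl⟩ := h
  obtain rfl := List.length_eq_zero_iff.1 hl
  simp

theorem IsConjProd.succ {k m : ℕ} {g : FreeGroup X} (h : IsConjProd R (k + 1) m g) :
    ∃ a, ∃ r ∈ R, ∃ g' m', g = a * r * a⁻¹ * g' ∧ m = r.norm + m' ∧ IsConjProd R k m' g' := by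
  obtain ⟨l, ⟨h, rfl⟩, hl, rfl⟩ := h
  cases l with
  | nil => simp at hl
  | cons p l =>
    exact ⟨p.1, p.2, h p (by simp), _, _, by simp, by simp,
      l, ⟨fun q hq => h q (by simp [hq]), rfl⟩, by simpa using hl, rfl⟩

theorem IsConjProd.conj {k m : ℕ} {g : FreeGroup X} (h : IsConjProd R k m g) (a : FreeGroup X) :
    IsConjProd R k m (a * g * a⁻¹) := by
  induction k generalizing m g with
  | zero =>
    obtain ⟨rfl, rfl⟩ := h.zero
    simpa using IsConjProd.one
  | succ k ih =>
    obtain ⟨b, r, hr, g', m', rfl, rfl, h'⟩ := h.succ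
    have := (IsConjProd.single hr (a * b)).mul (ih h')
    convert this using 1
    · omega
    · group

theorem IsConjProd.comm {k m : ℕ} {g h : FreeGroup X} (hp : IsConjProd R k m (g * h)) :
    IsConjProd R k m (h * g) := by
  convert hp.conj h using 1
  group

theorem IsConjProd.inv (hR : ∀ r ∈ R, r⁻¹ ∈ R) {k m : ℕ} {g : FreeGroup X}
    (h : IsConjProd R k m g) : IsConjProd R k m g⁻¹ := by
  induction k generalizing m g with
  | zero =>
    obtain ⟨rfl, rfl⟩ := h.zero
    simpa using IsConjProd.one
  | succ k ih =>
    obtain ⟨b, r, hr, g', m', rfl, rfl, h'⟩ := h.succ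
    have := (ih h').mul (IsConjProd.single (hR r hr) b)
    rw [norm_inv_eq, add_comm m'] at this
    convert this using 1
    group

/-! ### The dichotomy for a boundary letter -/

/-- The letter `x` of `x g` lies on an element `r = v x u` of `R`, and removing `r` from `x g`
leaves a product of conjugates with one factor less. -/
def Exposed (R : Set (FreeGroup X)) (k m : ℕ) (x : X × Bool) (g : FreeGroup X) : Prop :=
  ∃ r ∈ R, ∃ v u k' m', r.toWord = v ++ x :: u ∧ k = k' + 1 ∧ m = m' + r.norm ∧
    IsConjProd R k' m' ((mk v)⁻¹ * (mk u)⁻¹ * g)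

theorem Exposed.mul_right {k m k' m' : ℕ} {x : X × Bool} {g h : FreeGroup X}
    (hg : Exposed R k m x g) (hh : IsConjProd R k' m' h) :
    Exposed R (k + k') (m + m') x (g * h) := by
  obtain ⟨r, hr, v, u, k₁, m₁, e, rfl, rfl, hp⟩ := hg
  refine ⟨r, hr, v, u, k₁ + k', m₁ + m', e, by omega, by omega, ?_⟩
  simpa [mul_assoc] using hp.mul hh

theorem Exposed.mul_left {k m k' m' : ℕ} {x : X × Bool} {g h : FreeGroup X}
    (hg : Exposed R k m x g) (hh : IsConjProd R k' m' h) :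
    Exposed R (k + k') (m + m') x (h * g) := by
  -- `h g = g (g⁻¹ h g)`, and conjugation preserves both counts.
  have := hg.mul_right (hh.conj g⁻¹)
  convert this using 1
  group

/-- The letter `x` of the word `x w` is matched with a letter `x⁻¹` of `w`. -/
def Mated (R : Set (FreeGroup X)) (k m : ℕ) (x : X × Bool) (w : List (X × Bool)) : Prop :=
  ∃ p q k₁ k₂ m₁ m₂, w = p ++ (x.1, !x.2) :: q ∧ k = k₁ + k₂ ∧ m = m₁ + m₂ ∧
    IsConjProd R k₁ m₁ (mk p) ∧ IsConjProd R k₂ m₂ (mk q)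

/-- Induction on the length of the conjugator `a`. The first letter of the trivial word `x w a r⁻¹
a⁻¹` cancels against some `x⁻¹`. If this lies in `w`, the letter is mated; in `r⁻¹`, exposed; in
`a`, the conjugator can be shortened; in `a⁻¹`, a second cancellation decides. -/
theorem exposed_or_mated_one {r : FreeGroup X} (hr : r ∈ R)
    {w : List (X × Bool)} {x : X × Bool} (n : ℕ) :
    ∀ a : List (X × Bool), a.length = n → mk [x] * mk w = mk a * r * (mk a)⁻¹ →
      Exposed R 1 r.norm x (mk w) ∨ Mated R 1 r.norm x w := by
  induction n using Nat.strong_induction_on with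
  | _ n ih =>
  rintro a rfl h
  have hinv : mk (invRev r.toWord) = r⁻¹ := by rw [mk_invRev, mk_toWord]
  have hexp : ∀ e f, invRev r.toWord = e ++ (x.1, !x.2) :: f → mk f * mk e * mk w = 1 →
      Exposed R 1 r.norm x (mk w) := fun e f hs h1 =>
    ⟨r, hr, invRev f, invRev e, 0, 0, invRev_split hs, rfl, by simp, by
      rw [mk_invRev, mk_invRev, inv_inv, inv_inv, h1]; exact .one⟩
  have hw : mk w = (mk [x])⁻¹ * (mk a * r * (mk a)⁻¹) := by rw [← h]; group
  obtain ⟨p, q, e, hp, hq⟩ := split_of_mul_eq_one (x := x)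
    (w := w ++ (a ++ (invRev r.toWord ++ invRev a)))
    (by simp only [mk_append, hinv, mk_invRev, hw]; group)
  rcases split_of_append_eq e with ⟨t, rfl, rfl⟩ | ⟨t, e', rfl⟩
  · refine .inr ⟨p, t, 0, 1, 0, r.norm, rfl, rfl, by simp, by rw [hp]; exact .one, ?_⟩
    have : mk t = mk a * r * (mk a)⁻¹ := by
      simp only [mk_append, hinv, mk_invRev] at hq
      rw [← mul_inv_eq_one, ← hq]; group
    rw [this]; exact .single hr _
  clear e
  rcases split_of_append_eq e' with ⟨t', rfl, rfl⟩ | ⟨t, e, rfl⟩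
  · refine ih t'.length (by simp; omega) t' rfl ?_
    simp only [mk_append, hinv, mk_invRev, mk_cons _ t', mk_inv_letter] at hp hq
    rw [eq_inv_of_mul_eq_one_left hp]
    symm
    rw [← inv_mul_eq_one, ← hq]; group
  rcases split_of_append_eq e with ⟨f, e₂, rfl⟩ | ⟨c, e₂, rfl⟩
  · refine .inl (hexp _ _ e₂ ?_)
    simp only [mk_append, mk_invRev] at hp hq
    rw [← mul_assoc] at hp
    rw [eq_inv_of_mul_eq_one_right hp, eq_inv_of_mul_eq_one_left hq]; group
  have ea := invRev_split e₂
  have ha : mk a = mk [x] * (mk c)⁻¹ := by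
    rw [ea, mk_append, mk_cons x, mk_invRev, mk_invRev, hq]; group
  have hl : a.length = q.length + c.length + 1 := by
    rw [ea]; simp [invRev_length]; omega
  rw [ha] at hw
  -- Since `a = x c⁻¹` in the free group, `x c⁻¹ r⁻¹ c w` is trivial as well; its first letter again
  -- has a partner.
  obtain ⟨p, s, e, hp, hs⟩ := split_of_mul_eq_one (x := x)
    (w := invRev c ++ (invRev r.toWord ++ (c ++ w)))
    (by simp only [mk_append, hinv, mk_invRev, hw]; group)
  rcases split_of_append_eq e with ⟨f, e', rfl⟩ | ⟨t, e', rfl⟩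
  · have hc : (mk c)⁻¹ = (mk [x])⁻¹ * mk f := by
      rw [← mk_invRev, e', mk_split, hp]; group
    have hcl : c.length = p.length + 1 + f.length := by
      rw [← invRev_length, e']; simp; omega
    refine ih f.length (by omega) f rfl ?_
    rw [h, ha, hc]; group
  clear e
  rcases split_of_append_eq e' with ⟨f, e, rfl⟩ | ⟨t', e, rfl⟩
  · refine .inl (hexp _ _ e ?_)
    simp only [mk_append, mk_invRev] at hp hs
    have : mk t = mk c := by rw [← inv_mul_eq_one, ← inv_eq_one, ← hp]; group
    rw [this, mul_assoc, hs]
  clear e'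
  rcases split_of_append_eq e with ⟨f, rfl, rfl⟩ | ⟨t, rfl, rfl⟩
  -- The new conjugator `x t'⁻¹` equals `a r⁻¹`, and `r⁻¹` commutes with `r`.
  · refine ih (x :: invRev t').length (by simp [invRev_length] at hl ⊢; omega) _ rfl ?_
    simp only [mk_append, mk_invRev, hinv, mk_cons x (invRev t')] at hp hs ⊢
    have ht : mk t' = r * mk (t' ++ (x.1, !x.2) :: f) := by
      rw [mk_append, inv_mul_eq_one.1 hp, mul_inv_cancel_left]
    rw [h, ha, ht]; group
  · refine .inr ⟨t, s, 1, 0, r.norm, 0, rfl, rfl, by simp, ?_, by rw [hs]; exact .one⟩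
    simp only [mk_append, mk_invRev, hinv] at hp
    have : mk t = (mk c)⁻¹ * r * ((mk c)⁻¹)⁻¹ := by
      rw [inv_inv, mul_assoc, eq_inv_mul_iff_mul_eq, ← inv_mul_eq_iff_eq_mul]
      exact (inv_mul_eq_one.1 hp).symm
    rw [this]; exact .single hr _

/-- With at least two factors, a path `a` cuts the diagram into parts with boundaries `x a` and `a⁻¹
w`, each with fewer factors. Either the dichotomy for smaller products settles the claim, or it
supplies a shorter cut. -/
theorem exposed_or_mated {x : X × Bool} (k : ℕ) :
    ∀ (m : ℕ) (w : List (X × Bool)), IsConjProd R k m (mk [x] * mk w) →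
      Exposed R k m x (mk w) ∨ Mated R k m x w := by
  induction k using Nat.strong_induction_on with
  | _ K IH =>
  intro M w hM
  rcases Nat.lt_or_ge K 2 with hK | hK
  · interval_cases K
    · obtain ⟨h, rfl⟩ := hM.zero
      obtain ⟨p, q, rfl, hp, hq⟩ := split_of_mul_eq_one h
      exact .inr ⟨p, q, 0, 0, 0, 0, rfl, rfl, rfl, hp ▸ .one, hq ▸ .one⟩
    · obtain ⟨a, r, hr, g, m, h, rfl, hg⟩ := hM.succ
      obtain ⟨rfl, rfl⟩ := hg.zero
      exact exposed_or_mated_one hr _ a.toWord rfl (by simpa [mk_toWord] using h)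
  suffices H : ∀ (n : ℕ) (a : List (X × Bool)), a.length = n → ∀ p q mp mq, 1 ≤ p → 1 ≤ q →
      K = p + q → M = mp + mq → IsConjProd R p mp (mk [x] * mk a) →
      IsConjProd R q mq ((mk a)⁻¹ * mk w) → Exposed R K M x (mk w) ∨ Mated R K M x w by
    obtain ⟨K, rfl⟩ : ∃ k, K = k + 1 := ⟨K - 1, by omega⟩
    obtain ⟨a, r, hr, g, m, h, rfl, hg⟩ := hM.succ
    -- The initial cut separates the first conjugate from the rest.
    refine H _ ((mk [x])⁻¹ * (a * r * a⁻¹)).toWord rfl 1 K r.norm m le_rfl (by omega)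
      (by omega) rfl ?_ ?_
    · rw [mk_toWord, mul_inv_cancel_left]; exact .single hr a
    · rw [mk_toWord]
      have : ((mk [x])⁻¹ * (a * r * a⁻¹))⁻¹ * mk w = (a * r * a⁻¹)⁻¹ * (mk [x] * mk w) := by group
      rw [this, h, inv_mul_cancel_left]; exact hg
  intro n
  induction n using Nat.strong_induction_on with
  | _ n ih =>
  rintro a rfl p q mp mq hp hq rfl rfl h₁ h₂
  rcases IH p (by omega) mp a h₁ with h | ⟨s, t, j, i, mj, mi, rfl, rfl, rfl, hs, ht⟩
  · left
    have := h.mul_right h₂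
    rwa [mul_inv_cancel_left] at this
  rw [mk_split] at h₁ h₂
  -- Now `a = s x⁻¹ t`. If `s` is trivial, `x w t⁻¹` has only the `q` factors of the second part;
  -- otherwise the `j` factors of `s` are split off, leaving `i + q` for `x s⁻¹ w`.
  rcases Nat.eq_zero_or_pos j with rfl | hj
  · obtain ⟨hs', rfl⟩ := hs.zero
    rw [hs'] at h₁ h₂
    have h₃ : IsConjProd R q mq (mk [x] * mk (w ++ invRev t)) := by
      rw [mk_append, mk_invRev]
      convert (show IsConjProd R q mq ((mk t)⁻¹ * (mk [x] * mk w)) by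
        convert h₂ using 1; group).comm using 1
      group
    rcases IH q (by omega) mq _ h₃ with h | ⟨c, d, q₁, q₂, n₁, n₂, e, rfl, rfl, hc, hd⟩
    · left
      have := h.mul_right ht
      rw [mk_append, mk_invRev, inv_mul_cancel_right] at this
      convert this using 1 <;> omega
    rcases split_of_append_eq e with ⟨d', rfl, rfl⟩ | ⟨c', e', rfl⟩
    · refine .inr ⟨c, d', q₁, q₂ + i, n₁, n₂ + mi, rfl, by omega, by omega, hc, ?_⟩
      have := hd.mul ht
      rwa [mk_append, mk_invRev, inv_mul_cancel_right] at this
    have et := invRev_split e'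
    have htl : t.length = d.length + c'.length + 1 := by
      rw [et]; simp [invRev_length]; omega
    have htm : mk t = (mk d)⁻¹ * mk [x] * (mk c')⁻¹ := by
      rw [et, mk_append, mk_cons x, mk_invRev, mk_invRev]; group
    rw [mk_append] at hc
    -- The cut along `c'⁻¹` leaves `q₂ + i` and `q₁` factors, so it needs `q₁ > 0`. If `q₁ = 0`,
    -- then `w c' = 1` and the cut along `x⁻¹ d` leaves `q₂` and `i`. Both are shorter than `a`.
    rcases Nat.eq_zero_or_pos q₁ with rfl | hq₁
    · obtain ⟨hc', rfl⟩ := hc.zero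
      refine ih _ ?_ ((x.1, !x.2) :: d) rfl q₂ i n₂ mi (by omega) (by omega) (by omega) (by omega)
        ?_ ?_
      · simp; omega
      · rw [mk_cons _ d, mk_inv_letter, mul_inv_cancel_left]; exact hd
      · rw [mk_cons _ d, mk_inv_letter, eq_inv_of_mul_eq_one_left hc']
        convert ht using 1
        rw [htm]; group
    · refine ih _ ?_ (invRev c') rfl (q₂ + i) q₁ (n₂ + mi) n₁ (by omega) hq₁ (by omega) (by omega)
        ?_ ?_
      · simp [invRev_length]; omega
      · convert hd.mul ht using 1
        rw [htm, mk_invRev]; group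
      · rw [mk_invRev, inv_inv]; exact hc.comm
  · have h₃ : IsConjProd R (i + q) (mi + mq) (mk [x] * mk (invRev s ++ w)) := by
      rw [mk_append, mk_invRev]
      convert ht.mul h₂ using 1
      group
    rcases IH (i + q) (by omega) _ _ h₃ with h | ⟨c, d, q₁, q₂, n₁, n₂, e, e₁, e₂, hc, hd⟩
    · left
      have := h.mul_left hs
      rw [mk_append, mk_invRev, mul_inv_cancel_left] at this
      convert this using 1 <;> omega
    rcases split_of_append_eq e with ⟨d', e', rfl⟩ | ⟨c', rfl, rfl⟩
    · have es := invRev_split e'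
      have hsl : s.length = d'.length + c.length + 1 := by
        rw [es]; simp [invRev_length]; omega
      have hsm : mk s = (mk d')⁻¹ * mk [x] * (mk c)⁻¹ := by
        rw [es, mk_append, mk_cons x, mk_invRev, mk_invRev]; group
      rw [mk_append] at hd
      -- The mirror image: cut along `d'⁻¹` if `q₂ > 0`, along `c x⁻¹` otherwise.
      rcases Nat.eq_zero_or_pos q₂ with rfl | hq₂
      · obtain ⟨hd', rfl⟩ := hd.zero
        refine ih _ ?_ (c ++ [(x.1, !x.2)]) rfl q₁ j n₁ mj (by omega) hj (by omega) (by omega)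
          ?_ ?_
        · simp; omega
        · rw [mk_append, mk_inv_letter, ← mul_assoc]; exact hc.conj _
        · rw [mk_append, mk_inv_letter, eq_inv_of_mul_eq_one_right hd']
          rw [hsm, mul_assoc] at hs
          convert hs.comm using 1
          group
      · refine ih _ ?_ (invRev d') rfl (j + q₁) q₂ (mj + n₁) n₂ (by omega) hq₂ (by omega)
          (by omega) ?_ ?_
        · simp [invRev_length]; omega
        · have := hs.mul hc
          rw [hsm, inv_mul_cancel_right] at this
          rw [mk_invRev]; exact this.comm
        · rw [mk_invRev, inv_inv]; exact hd
    · refine .inr ⟨c', d, j + q₁, q₂, mj + n₁, n₂, rfl, by omega, by omega, ?_, hd⟩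
      have := hs.mul hc
      rwa [mk_append, mk_invRev, mul_inv_cancel_left] at this

/-! ### From products of conjugates to derivations and back -/

theorem derives_invRev_mul (R : Set (FreeGroup X)) (v : List (X × Bool)) :
    Derives (toMonoid R) v.length (2 * v.length) (FreeMonoid.ofList (invRev v ++ v)) 1 := by
  induction v with
  | nil => exact .refl _
  | cons a v ih =>
    have h : (FreeMonoid.of (a.1, !a.2) * FreeMonoid.of a, 1) ∈ symmetrized (toMonoid R) :=
      .inl (.inr ⟨a.1, !a.2, by simp⟩)
    have := ((Derives.of_mem h).context (FreeMonoid.ofList (invRev v)) (FreeMonoid.ofList v)).comp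
      (by simpa using ih)
    convert this using 1
    · simp; omega
    · simp; omega
    · simp [invRev, mul_assoc, FreeMonoid.ofList_append, FreeMonoid.ofList_cons]

theorem IsConjProd.exists_derives (k : ℕ) :
    ∀ (n : ℕ) (w : List (X × Bool)) (m : ℕ), w.length = n → IsConjProd R k m (mk w) →
      ∃ s t, Derives (toMonoid R) s t (FreeMonoid.ofList w) 1 ∧
        2 * s ≤ w.length + 3 * m ∧ t ≤ w.length + 4 * m := by
  induction k using Nat.strong_induction_on with
  | _ k ihk =>
  intro n
  induction n using Nat.strong_induction_on with
  | _ n ihn =>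
  rintro w m rfl h
  rcases w with _ | ⟨x, w⟩
  · exact ⟨0, 0, .refl _, by simp, by simp⟩
  rw [mk_cons] at h
  rcases exposed_or_mated k m w h with
    ⟨r, hr, v, u, k, m, e, rfl, rfl, hp⟩ | ⟨p, q, k₁, k₂, m₁, m₂, rfl, rfl, rfl, hp, hq⟩
  -- Insert `v⁻¹ v` before `x` (`|v|` steps, work `2|v|`), then replace `v x` by `u⁻¹` (one step,
  -- work `|r|`). The word grows by at most `|r|`, and `|v| < |r|`; this accounts for the constants
  -- 3 and 4.
  · have hrl : r.norm = v.length + 1 + u.length := by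
      simp only [FreeGroup.norm, e, List.length_append, List.length_cons]; omega
    obtain ⟨s, t, hd, hs, ht⟩ := ihk k (by omega) _ (invRev v ++ (invRev u ++ w)) m rfl
      (by rw [mk_append, mk_append, mk_invRev, mk_invRev, ← mul_assoc]; exact hp)
    have hm : (FreeMonoid.ofList (v ++ [x]), FreeMonoid.ofList (invRev u)) ∈
        symmetrized (toMonoid R) :=
      .inl (.inl ⟨r, hr, v ++ [x], u, by simp [e], rfl⟩)
    have h₁ := (derives_invRev_mul R v).reverse.context 1 (FreeMonoid.ofList (x :: w))
    have h₂ := (Derives.of_mem hm).context (FreeMonoid.ofList (invRev v)) (FreeMonoid.ofList w)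
    simp only [one_mul] at h₁
    have e₁ : FreeMonoid.ofList (invRev v ++ v) * FreeMonoid.ofList (x :: w) =
        FreeMonoid.ofList (invRev v) * FreeMonoid.ofList (v ++ [x]) * FreeMonoid.ofList w := by
      simp only [← FreeMonoid.ofList_append]; simp
    have e₂ : FreeMonoid.ofList (invRev v ++ (invRev u ++ w)) =
        FreeMonoid.ofList (invRev v) * FreeMonoid.ofList (invRev u) * FreeMonoid.ofList w := by
      simp [← FreeMonoid.ofList_append]
    rw [e₁] at h₁
    rw [e₂] at hd
    have hl₁ : (FreeMonoid.ofList (v ++ [x])).length = v.length + 1 := by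
      simp [FreeMonoid.length]
    have hl₂ : (FreeMonoid.ofList (invRev u)).length = u.length := by
      simp [FreeMonoid.length]
    refine ⟨_, _, (h₁.comp h₂).comp hd, ?_, ?_⟩
    · rw [List.length_append, List.length_append, invRev_length, invRev_length] at hs
      rw [List.length_cons]; omega
    · rw [List.length_append, List.length_append, invRev_length, invRev_length] at ht
      rw [List.length_cons, hl₁, hl₂]; omega
  -- One of `p`, `q` may keep all the factors but is a shorter word, hence the inner induction on
  -- length. Erase `p`, cancel `x x⁻¹`, erase `q`.
  · have hpq : ∀ k' m' w', k' ≤ k₁ + k₂ → w'.length < (x :: (p ++ (x.1, !x.2) :: q)).length →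
        IsConjProd R k' m' (mk w') → ∃ s t, Derives (toMonoid R) s t (FreeMonoid.ofList w') 1 ∧
        2 * s ≤ w'.length + 3 * m' ∧ t ≤ w'.length + 4 * m' := by
      intro k' m' w' hk hw hc
      rcases hk.eq_or_lt with rfl | hk
      · exact ihn _ hw _ _ rfl hc
      · exact ihk _ hk _ _ _ rfl hc
    obtain ⟨s₁, t₁, hd₁, hs₁, ht₁⟩ := hpq _ _ p (by omega) (by simp) hp
    obtain ⟨s₂, t₂, hd₂, hs₂, ht₂⟩ := hpq _ _ q (by omega) (by simp; omega) hq
    have hx : (FreeMonoid.of x * FreeMonoid.of (x.1, !x.2), 1) ∈ symmetrized (toMonoid R) :=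
      .inl (.inr ⟨x.1, x.2, rfl⟩)
    have h₁ := hd₁.context (FreeMonoid.of x)
      (FreeMonoid.of (x.1, !x.2) * FreeMonoid.ofList q)
    have h₂ := (Derives.of_mem hx).context 1 (FreeMonoid.ofList q)
    have h := h₁.comp ((by simpa [mul_assoc] using h₂.comp (by simpa using hd₂) :
      Derives (toMonoid R) (1 + s₂) (2 + t₂) _ _))
    refine ⟨_, _, by simpa [mul_assoc] using h, ?_, ?_⟩
    · simp; omega
    · simp; omega

theorem Derives.exists_isConjProd (hR : ∀ r ∈ R, r⁻¹ ∈ R) {k m : ℕ}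
    {u v : FreeMonoid (X × Bool)} (h : Derives (toMonoid R) k m u v) :
    ∃ k' ≤ k, ∃ m' ≤ m, IsConjProd R k' m' (mk u.toList * (mk v.toList)⁻¹) := by
  have key : ∀ a b : FreeMonoid (X × Bool), (a, b) ∈ toMonoid R →
      ∃ k' ≤ 1, ∃ m' ≤ a.length + b.length,
        IsConjProd R k' m' (mk a.toList * (mk b.toList)⁻¹) := by
    rintro a b (⟨r, hr, u, v, e, h⟩ | ⟨x, b, h⟩)
    · rw [(Prod.mk.inj h).1, (Prod.mk.inj h).2]
      refine ⟨1, le_rfl, r.norm, by simp [FreeGroup.norm, e, FreeMonoid.length], ?_⟩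
      convert IsConjProd.single hr 1 using 1
      rw [← mk_toWord (x := r), e]
      simp only [FreeMonoid.toList_ofList, mk_invRev, mk_append]; group
    · obtain ⟨rfl, rfl⟩ := Prod.mk.inj h
      refine ⟨0, by simp, 0, by simp, ?_⟩
      convert IsConjProd.one (R := R) using 1
      have := mk_inv_letter (x, b)
      simp only at this
      rw [FreeMonoid.toList_mul, FreeMonoid.toList_of, FreeMonoid.toList_of, mk_append, this,
        FreeMonoid.toList_one, ← one_eq_mk]
      group
  have key' : ∀ a b : FreeMonoid (X × Bool), (a, b) ∈ symmetrized (toMonoid R) →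
      ∃ k' ≤ 1, ∃ m' ≤ a.length + b.length,
        IsConjProd R k' m' (mk a.toList * (mk b.toList)⁻¹) := by
    rintro a b (h | h)
    · exact key a b h
    · obtain ⟨k', hk, m', hm, h⟩ := key b a h
      exact ⟨k', hk, m', by omega, by simpa only [mul_inv_rev, inv_inv] using h.inv hR⟩
  induction h with
  | refl u => exact ⟨0, le_rfl, 0, le_rfl, by rw [mul_inv_cancel]; exact .one⟩
  | step x a b y _ hab ih =>
    obtain ⟨k₁, hk₁, m₁, hm₁, h₁⟩ := ih
    obtain ⟨k₂, hk₂, m₂, hm₂, h₂⟩ := key' a b hab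
    refine ⟨k₁ + k₂, by omega, m₁ + m₂, by omega, ?_⟩
    -- `u (x b y)⁻¹` is `u (x a y)⁻¹` times the conjugate of `a b⁻¹` by `x`.
    convert h₁.mul (h₂.conj (mk x.toList)) using 1
    simp only [FreeMonoid.toList_mul, mk_append]
    group

theorem IsConjProd.mem_normalClosure {k m : ℕ} {g : FreeGroup X} (h : IsConjProd R k m g) :
    g ∈ Subgroup.normalClosure R := by
  induction k generalizing m g with
  | zero => rw [h.zero.1]; exact one_mem _
  | succ k ih =>
    obtain ⟨a, r, hr, g, m, rfl, rfl, h'⟩ := h.succ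
    exact mul_mem (Subgroup.normalClosure_normal.conj_mem _
      (Subgroup.subset_normalClosure hr) _) (ih h')

theorem IsConjProd.area_le {k m : ℕ} {g : FreeGroup X} (h : IsConjProd R k m g) :
    area R g ≤ k := by
  obtain ⟨l, hl, hk, _⟩ := h
  exact Nat.sInf_le ⟨l, hl, hk⟩

theorem IsConjProd.gwork_le {k m : ℕ} {g : FreeGroup X} (h : IsConjProd R k m g) :
    gwork R g ≤ m := by
  obtain ⟨l, hl, _, hm⟩ := h
  exact Nat.sInf_le ⟨l, hl, hm⟩

theorem exists_isConjProd_area (hR : ∀ r ∈ R, r⁻¹ ∈ R) {g : FreeGroup X}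
    (hg : g ∈ Subgroup.normalClosure R) : ∃ m, IsConjProd R (area R g) m g := by
  obtain ⟨l, hl⟩ := exists_isProductOfConjugates hR hg
  obtain ⟨l, hl, hk⟩ := Nat.sInf_mem
    (s := {k | ∃ l, IsProductOfConjugates R l g ∧ l.length = k}) ⟨_, l, hl, rfl⟩
  exact ⟨_, l, hl, hk, rfl⟩

theorem exists_isConjProd_gwork (hR : ∀ r ∈ R, r⁻¹ ∈ R) {g : FreeGroup X}
    (hg : g ∈ Subgroup.normalClosure R) : ∃ k, IsConjProd R k (gwork R g) g := by
  obtain ⟨l, hl⟩ := exists_isProductOfConjugates hR hg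
  obtain ⟨l, hl, hk⟩ := Nat.sInf_mem
    (s := {m | ∃ l, IsProductOfConjugates R l g ∧ (l.map fun p => p.2.norm).sum = m})
    ⟨_, l, hl, rfl⟩
  exact ⟨_, l, hl, rfl, hk⟩

theorem IsConjProd.le_mul {k m c : ℕ} {g : FreeGroup X} (h : IsConjProd R k m g)
    (hc : ∀ r ∈ R, r.norm ≤ c) : m ≤ c * k := by
  induction k generalizing m g with
  | zero => rw [h.zero.2]; simp
  | succ k ih =>
    obtain ⟨a, r, hr, g, m, rfl, rfl, h'⟩ := h.succ
    have := ih h'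
    have := hc r hr
    rw [mul_add]; omega

theorem IsConjProd.eq_one {k : ℕ} {g : FreeGroup X} (h : IsConjProd R k 0 g) : g = 1 := by
  induction k generalizing g with
  | zero => exact h.zero.1
  | succ k ih =>
    obtain ⟨a, r, hr, g, m, rfl, hm, h'⟩ := h.succ
    obtain ⟨hr, rfl⟩ : r.norm = 0 ∧ m = 0 := by omega
    rw [norm_eq_zero.1 hr, ih h']; simp

theorem norm_mk_toList_le (u : FreeMonoid (X × Bool)) : (mk u.toList).norm ≤ u.length :=
  norm_mk_le

theorem relator_of_isRelation (hR : ∀ r ∈ R, r⁻¹ ∈ R) {u v : FreeMonoid (X × Bool)}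
    (h : IsRelation (toMonoid R) u v) (hv : v.length ≤ 0) :
    v = 1 ∧ mk u.toList ∈ Subgroup.normalClosure R := by
  obtain rfl : v = 1 := FreeMonoid.length_eq_zero.1 (by omega)
  obtain ⟨k, m, h⟩ := isRelation_iff.1 h
  obtain ⟨k', _, m', _, h⟩ := h.exists_isConjProd hR
  exact ⟨rfl, by simpa [← one_eq_mk] using h.mem_normalClosure⟩

/-! ### Comparison of the functions -/

theorem two_mul_DL_le [Finite X] (hR : ∀ r ∈ R, r⁻¹ ∈ R) {n c : ℕ}
    (hc : ∀ r ∈ R, r.norm ≤ c) :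
    2 * DL (toMonoid R) n 0 ≤ n + 3 * (c * dehn R n) := by
  obtain ⟨u, v, h, hu, hv, e⟩ := (isGreatest_DL (toMonoid R) n 0).1
  obtain ⟨rfl, hN⟩ := relator_of_isRelation hR h hv
  obtain ⟨m, hp⟩ := exists_isConjProd_area hR hN
  have h₁ := hp.le_mul hc
  have h₂ : area R (mk u.toList) ≤ dehn R n :=
    (isGreatest_dehn R n).2 ⟨_, hN, (norm_mk_toList_le u).trans hu, rfl⟩
  obtain ⟨s, t, hd, hs, -⟩ := hp.exists_derives _ _ _ _ rfl
  have h₃ : dl (toMonoid R) u 1 ≤ s := Nat.sInf_le ⟨t, hd⟩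
  have h₄ := Nat.mul_le_mul_left c h₂
  have h₅ : u.toList.length = u.length := rfl
  omega

theorem Work_le [Finite X] (hR : ∀ r ∈ R, r⁻¹ ∈ R) (n : ℕ) :
    Work (toMonoid R) n 0 ≤ n + 4 * groupWork R n := by
  obtain ⟨u, v, h, hu, hv, e⟩ := (isGreatest_Work (toMonoid R) n 0).1
  obtain ⟨rfl, hN⟩ := relator_of_isRelation hR h hv
  obtain ⟨k, hp⟩ := exists_isConjProd_gwork hR hN
  have h₂ : gwork R (mk u.toList) ≤ groupWork R n :=
    (isGreatest_groupWork R n).2 ⟨_, hN, (norm_mk_toList_le u).trans hu, rfl⟩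
  obtain ⟨s, t, hd, -, ht⟩ := hp.exists_derives _ _ _ _ rfl
  have h₃ : work (toMonoid R) u 1 ≤ t := Nat.sInf_le ⟨s, hd⟩
  have h₅ : u.toList.length = u.length := rfl
  omega

/-- Provides a derivation, so that `dl` and `work` are attained minima rather than the default `sInf
∅ = 0`. -/
theorem isRelation_toWord (hR : ∀ r ∈ R, r⁻¹ ∈ R) {w : FreeGroup X}
    (hw : w ∈ Subgroup.normalClosure R) :
    IsRelation (toMonoid R) (FreeMonoid.ofList w.toWord) 1 := by
  obtain ⟨m, hp⟩ := exists_isConjProd_area hR hw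
  rw [← mk_toWord (x := w)] at hp
  obtain ⟨s, t, hd, -⟩ := hp.exists_derives _ _ _ _ rfl
  exact isRelation_iff.2 ⟨s, t, hd⟩

theorem groupWork_le [Finite X] (hR : ∀ r ∈ R, r⁻¹ ∈ R) (n : ℕ) :
    groupWork R n ≤ Work (toMonoid R) n 0 := by
  obtain ⟨w, hw, hn, e⟩ := (isGreatest_groupWork R n).1
  have hrel := isRelation_toWord hR hw
  obtain ⟨k₀, m₀, h₀⟩ := isRelation_iff.1 hrel
  obtain ⟨k, hd⟩ := Nat.sInf_mem
    (s := {m | ∃ k, Derives (toMonoid R) k m (FreeMonoid.ofList w.toWord) 1}) ⟨m₀, k₀, h₀⟩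
  obtain ⟨_, _, m', hm, hp⟩ := hd.exists_isConjProd hR
  have h₁ : gwork R w ≤ m' := IsConjProd.gwork_le (by simpa [← one_eq_mk, mk_toWord] using hp)
  have h₂ := (isGreatest_Work (toMonoid R) n 0).2 ⟨_, 1, hrel, hn, by simp, rfl⟩
  rw [← e]
  exact (h₁.trans hm).trans h₂

theorem dehn_le [Finite X] (hR : ∀ r ∈ R, r⁻¹ ∈ R) (n : ℕ) :
    dehn R n ≤ DL (toMonoid R) n 0 := by
  obtain ⟨w, hw, hn, e⟩ := (isGreatest_dehn R n).1
  have hrel := isRelation_toWord hR hw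
  obtain ⟨k₀, m₀, h₀⟩ := isRelation_iff.1 hrel
  obtain ⟨m, hd⟩ := Nat.sInf_mem
    (s := {k | ∃ m, Derives (toMonoid R) k m (FreeMonoid.ofList w.toWord) 1}) ⟨k₀, m₀, h₀⟩
  obtain ⟨k', hk, _, _, hp⟩ := hd.exists_isConjProd hR
  have h₁ : area R w ≤ k' := IsConjProd.area_le (by simpa [← one_eq_mk, mk_toWord] using hp)
  have h₂ := (isGreatest_DL (toMonoid R) n 0).2 ⟨_, 1, hrel, hn, by simp, rfl⟩
  rw [← e]
  exact (h₁.trans hk).trans h₂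

theorem one_le_dehn [Finite X] (hR : ∀ r ∈ R, r⁻¹ ∈ R) {n : ℕ} {w : FreeGroup X}
    (hw : w ∈ Subgroup.normalClosure R) (h1 : w ≠ 1) (hn : w.norm ≤ n) : 1 ≤ dehn R n := by
  have h₂ := (isGreatest_dehn R n).2 ⟨w, hw, hn, rfl⟩
  refine le_trans (Nat.one_le_iff_ne_zero.2 fun h => h1 ?_) h₂
  obtain ⟨m, hp⟩ := exists_isConjProd_area hR hw
  rw [h] at hp
  exact hp.zero.1

theorem one_le_groupWork [Finite X] (hR : ∀ r ∈ R, r⁻¹ ∈ R) {n : ℕ} {w : FreeGroup X}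
    (hw : w ∈ Subgroup.normalClosure R) (h1 : w ≠ 1) (hn : w.norm ≤ n) :
    1 ≤ groupWork R n := by
  have h₂ := (isGreatest_groupWork R n).2 ⟨w, hw, hn, rfl⟩
  refine le_trans (Nat.one_le_iff_ne_zero.2 fun h => h1 ?_) h₂
  obtain ⟨k, hp⟩ := exists_isConjProd_gwork hR hw
  rw [h] at hp
  exact hp.eq_one

theorem one_le_of_norm_le (hR : ∀ r ∈ R, r⁻¹ ∈ R) {c : ℕ} (hc : ∀ r ∈ R, r.norm ≤ c)
    {w : FreeGroup X} (hw : w ∈ Subgroup.normalClosure R) (h1 : w ≠ 1) : 1 ≤ c := by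
  refine Nat.one_le_iff_ne_zero.2 fun h => h1 ?_
  obtain ⟨m, hp⟩ := exists_isConjProd_area hR hw
  have := hp.le_mul hc
  obtain rfl : m = 0 := by simpa [h] using this
  exact hp.eq_one

end ConjProd

theorem dl_self {A : Type*} (S : Set (FreeMonoid A × FreeMonoid A)) (u : FreeMonoid A) :
    dl S u u = 0 :=
  Nat.sInf_eq_zero.2 (.inl ⟨0, .refl u⟩)

theorem work_self {A : Type*} (S : Set (FreeMonoid A × FreeMonoid A)) (u : FreeMonoid A) :
    work S u u = 0 :=
  Nat.sInf_eq_zero.2 (.inl ⟨0, .refl u⟩)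

theorem DL_zero_zero {A : Type*} [Finite A] (S : Set (FreeMonoid A × FreeMonoid A)) :
    DL S 0 0 = 0 := by
  obtain ⟨u, v, _, hu, hv, e⟩ := (isGreatest_DL S 0 0).1
  obtain rfl : u = 1 := FreeMonoid.length_eq_zero.1 (by omega)
  obtain rfl : v = 1 := FreeMonoid.length_eq_zero.1 (by omega)
  rw [← e, dl_self]

theorem Work_zero_zero {A : Type*} [Finite A] (S : Set (FreeMonoid A × FreeMonoid A)) :
    Work S 0 0 = 0 := by
  obtain ⟨u, v, _, hu, hv, e⟩ := (isGreatest_Work S 0 0).1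
  obtain rfl : u = 1 := FreeMonoid.length_eq_zero.1 (by omega)
  obtain rfl : v = 1 := FreeMonoid.length_eq_zero.1 (by omega)
  rw [← e, work_self]

end Presentation

theorem proposition6p3 {X : Type*} [DecidableEq X] [Finite X] (R : Set (FreeGroup X))
    (hR : ∀ r ∈ R, r⁻¹ ∈ R) (n : ℕ) :
    -- lower bounds, for every `n`
    (Presentation.groupWork R n ≤ Presentation.Work (Presentation.toMonoid R) n 0 ∧
      Presentation.dehn R n ≤ Presentation.DL (Presentation.toMonoid R) n 0) ∧
    -- upper bounds
    ((n = 0 ∨ ∃ w ∈ Subgroup.normalClosure R, w ≠ 1 ∧ w.norm ≤ n) →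
      ((Presentation.Work (Presentation.toMonoid R) n 0 : ℝ) ≤
          4 * (Presentation.groupWork R n : ℝ) ^ 3 + (Presentation.groupWork R n : ℝ) ^ 2
            + (4 * (n : ℝ) + 1) * (Presentation.groupWork R n : ℝ) - (n : ℝ)) ∧
      ∀ c : ℕ, (∀ r ∈ R, r.norm ≤ c) →
        ((Presentation.DL (Presentation.toMonoid R) n 0 : ℝ) ≤
            2 * (c : ℝ) * (Presentation.dehn R n : ℝ) ^ 2
              + (2 * (n : ℝ) + (c : ℝ) / 2 + 1) * (Presentation.dehn R n : ℝ) - (n : ℝ) / 2) ∧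
        ((Presentation.Work (Presentation.toMonoid R) n 0 : ℝ) ≤
            4 * (c : ℝ) * (Presentation.groupWork R n : ℝ) ^ 2
              + (4 * (n : ℝ) + (c : ℝ) + 1) * (Presentation.groupWork R n : ℝ) - (n : ℝ))) := by
  refine ⟨⟨Presentation.groupWork_le hR n, Presentation.dehn_le hR n⟩, ?_⟩
  rintro (rfl | ⟨w, hw, h1, hn⟩)
  · rw [Presentation.Work_zero_zero, Presentation.DL_zero_zero]
    have hg := Nat.cast_nonneg (α := ℝ) (Presentation.groupWork R 0)
    have hd := Nat.cast_nonneg (α := ℝ) (Presentation.dehn R 0)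
    refine ⟨?_, fun c _ => ⟨?_, ?_⟩⟩ <;> simp only [Nat.cast_zero, sub_zero, zero_div, mul_zero]
      <;> positivity
  have hn1 : (1 : ℝ) ≤ n := by
    have : w.norm ≠ 0 := fun h => h1 (FreeGroup.norm_eq_zero.1 h)
    exact_mod_cast (show 1 ≤ n by omega)
  have hΩ : (1 : ℝ) ≤ Presentation.groupWork R n := by
    exact_mod_cast Presentation.one_le_groupWork hR hw h1 hn
  have hΔ : (1 : ℝ) ≤ Presentation.dehn R n := by
    exact_mod_cast Presentation.one_le_dehn hR hw h1 hn
  have hW : (Presentation.Work (Presentation.toMonoid R) n 0 : ℝ) ≤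
      n + 4 * Presentation.groupWork R n := by
    exact_mod_cast Presentation.Work_le hR n
  generalize (Presentation.groupWork R n : ℝ) = Ω at *
  have hnΩ : (n : ℝ) ≤ n * Ω := le_mul_of_one_le_right (by linarith) hΩ
  have hsq : Ω ≤ Ω ^ 2 := le_self_pow₀ hΩ two_ne_zero
  refine ⟨?_, fun c hc => ?_⟩
  -- `n + 4Ω` is absorbed through `2n ≤ 4nΩ` and `4Ω ≤ 4Ω³`.
  · have hcu : Ω ≤ Ω ^ 3 := le_self_pow₀ hΩ three_ne_zero
    linarith
  have hc1 : (1 : ℝ) ≤ c := by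
    exact_mod_cast Presentation.one_le_of_norm_le hR hc hw h1
  have hD : 2 * (Presentation.DL (Presentation.toMonoid R) n 0 : ℝ) ≤
      n + 3 * (c * Presentation.dehn R n) := by
    exact_mod_cast Presentation.two_mul_DL_le hR hc
  generalize (Presentation.dehn R n : ℝ) = Δ at *
  constructor
  · have hnΔ : (n : ℝ) ≤ n * Δ := le_mul_of_one_le_right (by linarith) hΔ
    have hcΔ : (c : ℝ) * Δ ≤ c * Δ ^ 2 :=
      mul_le_mul_of_nonneg_left (le_self_pow₀ hΔ two_ne_zero) (by linarith)
    have : (0 : ℝ) ≤ c * Δ := by positivity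
    linarith
  · have hcΩ : Ω ^ 2 ≤ c * Ω ^ 2 := le_mul_of_one_le_left (by positivity) hc1
    have : 0 ≤ (c : ℝ) * Ω := by positivity
    linarith
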